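/- Let $S$ be a finite nonempty set and let $p:2^S\to\mathbb Z\cup\{-\infty\}$ be supermodular, i.e. $p(X)+p(Y)\le p(X\cap Y)+p(X\cup Y)$ for all $X,Y\subseteq S$, with $p(\emptyset)=0$ and $p(S)$ finite. Let $B=\{x\in\mathbb R^S : \sum_{s\in S}x(s)=p(S),\ \sum_{s\in Z}x(s)\ge p(Z)\text{ for all }Z\subseteq S\}$ be the base-polyhedron of $p$. For $\pi\in\mathbb Z^S$ let $\hat p(\pi)\in\mathbb Z\cup\{-\infty\}$ be the linear (Lovász) extension $$\hat p(\pi)=p(I_n)\,\pi(s_n)+\sum_{j=1}^{n-1}p(I_j)\,[\pi(s_j)-\pi(s_{j+1})],$$ where $n=|S|$, the elements of $S$ are indexed so that $\pi(s_1)\ge\dots\ge\pi(s_n)$, $I_j=\{s_1,\dots,s_j\}$, and $(-\infty)\cdot 0=0$. For integers $a\ge 1$ and $\ell$ put $$\psi_a(\ell)=k\,(\ell-a k),\qquad k=\left\lfloor \tfrac12\left(\tfrac{\ell}{a}+1\right)\right\rfloor .$$ Let $c\in\mathbb Z^S$ with $c(s)\ge 1$ for every $s\in S$. Then the minimum and the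 maximum below are attained, are finite, and satisfy $$\min\Big\{\sum_{s\in S}c(s)\,x(s)^2 : x\in B\cap\mathbb Z^S\Big\}=\max\Big\{\hat p(\pi)-\sum_{s\in S}\psi_{c(s)}(\pi(s)) : \pi\in\mathbb Z^S\Big\}.$$ Moreover, for every $s\in S$, $\psi_{c(s)}$ is the integer conjugate of $k\mapsto c(s)k^2$: for every $\ell\in\mathbb Z$, $\psi_{c(s)}(\ell)=\max\{k\ell-c(s)k^2 : k\in\mathbb Z\}$. -/

import Mathlib

section Defs

variable {S : Type*} [Fintype S]

/-- A set function with values in `ℤ ∪ {-∞}` is (fully) supermodular if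
`p X + p Y ≤ p (X ∩ Y) + p (X ∪ Y)` for all `X, Y`. As `⊥` is absorbing for addition, the
inequality is void when `p X` or `p Y` is `-∞`, and it forces `p (X ∩ Y)` and `p (X ∪ Y)` to be
finite when `p X` and `p Y` are. -/
def IsSupermodular [DecidableEq S] (p : Finset S → WithBot ℤ) : Prop :=
  ∀ X Y : Finset S, p X + p Y ≤ p (X ∩ Y) + p (X ∪ Y)

/-- The base-polyhedron `{x ∈ ℝ^S : x(S) = p(S), x(Z) ≥ p(Z) for all Z ⊆ S}`, where
`x(Z)` is the sum of `x` over `Z`. -/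
def basePolyhedron (p : Finset S → WithBot ℤ) : Set (S → ℝ) :=
  {x | ((∑ s, x s : ℝ) : WithBot ℝ) = (p Finset.univ).map (fun k : ℤ => (k : ℝ)) ∧
    ∀ Z : Finset S, (p Z).map (fun k : ℤ => (k : ℝ)) ≤ ((∑ s ∈ Z, x s : ℝ) : WithBot ℝ)}

/-- The integral members of a subset of `ℝ^S`, as integer vectors. -/
def integralPoints (B : Set (S → ℝ)) : Set (S → ℤ) :=
  {x | (fun s => (x s : ℝ)) ∈ B}

/-- The initial segment `{s_0, …, s_j}` of an enumeration `s_0, …, s_m` of `S`. -/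
def initialSegment {m : ℕ} (e : Fin (m + 1) ≃ S) (j : Fin (m + 1)) : Finset S :=
  (Finset.Iic j).map e.toEmbedding

/-- The expression defining the linear (Lovász) extension of `p` at `π`, for a given enumeration
`s_0, …, s_m` of `S`:
`p(I_m) π(s_m) + ∑_{j < m} p(I_j) (π(s_j) - π(s_{j+1}))`.
The product in `WithBot ℤ` satisfies `⊥ * 0 = 0`, and `⊥ * k = ⊥` for `k ≠ 0`. -/
def lovaszAlong (p : Finset S → WithBot ℤ) (π : S → ℤ) {m : ℕ} (e : Fin (m + 1) ≃ S) :
    WithBot ℤ :=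
  p (initialSegment e (Fin.last m)) * ((π (e (Fin.last m)) : ℤ) : WithBot ℤ) +
    ∑ j : Fin m, p (initialSegment e j.castSucc) *
      ((π (e j.castSucc) - π (e j.succ) : ℤ) : WithBot ℤ)

/-- The elements of `S` can be listed in the order of non-increasing values of `π`. -/
theorem exists_antitone_enum [Nonempty S] (π : S → ℤ) :
    ∃ e : Fin (Fintype.card S - 1 + 1) ≃ S, Antitone (π ∘ e) := by
  have hc : Fintype.card S = Fintype.card S - 1 + 1 :=
    (Nat.sub_add_cancel Fintype.card_pos).symm
  let e₀ : Fin (Fintype.card S - 1 + 1) ≃ S := (Fintype.equivFinOfCardEq hc).symm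
  let f : Fin (Fintype.card S - 1 + 1) → ℤ := fun i => -π (e₀ i)
  refine ⟨(Tuple.sort f).trans e₀, fun i j hij => ?_⟩
  have h := Tuple.monotone_sort f hij
  simp only [f, Function.comp_apply] at h
  simpa using h

/-- The linear (Lovász) extension of the set function `p`, for an enumeration of `S` along which
`π` is non-increasing; by `lovaszExtension_eq` it does not depend on the enumeration. -/
noncomputable def lovaszExtension [Nonempty S] (p : Finset S → WithBot ℤ) (π : S → ℤ) :
    WithBot ℤ :=
  lovaszAlong p π (exists_antitone_enum π).choose

theorem initialSegment_eq_of_lt {m : ℕ} (π : S → ℤ) (e : Fin (m + 1) ≃ S)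
    (he : Antitone (π ∘ e)) (j : Fin m) (hj : π (e j.succ) < π (e j.castSucc)) :
    initialSegment e j.castSucc = Finset.univ.filter (fun s => π (e j.castSucc) ≤ π s) := by
  ext s
  obtain ⟨i, rfl⟩ := e.surjective s
  simp only [initialSegment, Finset.mem_map_equiv, Equiv.symm_apply_apply, Finset.mem_Iic,
    Finset.mem_filter, Finset.mem_univ, true_and]
  refine ⟨fun h => he h, fun h => ?_⟩
  by_contra hc
  have h1 : j.succ ≤ i := by
    rw [not_le] at hc
    exact Fin.castSucc_lt_iff_succ_le.mp hc
  have h2 : π (e i) ≤ π (e j.succ) := he h1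
  omega

theorem initialSegment_last {m : ℕ} (e : Fin (m + 1) ≃ S) :
    initialSegment e (Fin.last m) = Finset.univ := by
  ext s
  simp [initialSegment, Finset.mem_map_equiv, Fin.le_last]

/-- Two enumerations along which `π` is non-increasing give the same value. -/
theorem lovaszAlong_eq {m : ℕ} (p : Finset S → WithBot ℤ) (π : S → ℤ)
    (e e' : Fin (m + 1) ≃ S) (he : Antitone (π ∘ e)) (he' : Antitone (π ∘ e')) :
    lovaszAlong p π e = lovaszAlong p π e' := by
  have hval : ∀ i, π (e i) = π (e' i) := by
    have h := Tuple.unique_monotone (f := fun i => -π (e i)) (σ := Equiv.refl _)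
      (τ := e'.trans e.symm) (fun i j hij => neg_le_neg (he hij))
      (fun i j hij => by simpa using he' hij)
    intro i
    have hi := congrFun h i
    simpa using hi
  unfold lovaszAlong
  rw [initialSegment_last, initialSegment_last, hval]
  congr 1
  refine Finset.sum_congr rfl fun j _ => ?_
  have hle : π (e j.succ) ≤ π (e j.castSucc) := he (Fin.castSucc_lt_succ (i := j)).le
  rcases hle.lt_or_eq with hlt | heq
  · rw [initialSegment_eq_of_lt π e he j hlt,
      initialSegment_eq_of_lt π e' he' j (by rw [← hval, ← hval]; exact hlt)]
    simp only [hval]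
  · have h0 : π (e j.castSucc) - π (e j.succ) = 0 := by omega
    have h0' : π (e' j.castSucc) - π (e' j.succ) = 0 := by rw [← hval, ← hval]; exact h0
    rw [h0, h0']
    simp

theorem lovaszExtension_eq [Nonempty S] (p : Finset S → WithBot ℤ) (π : S → ℤ)
    (e : Fin (Fintype.card S - 1 + 1) ≃ S) (he : Antitone (π ∘ e)) :
    lovaszExtension p π = lovaszAlong p π e :=
  lovaszAlong_eq p π _ e (exists_antitone_enum π).choose_spec he

/-- The integer `⌊(ℓ / a + 1) / 2⌋`, computed in `ℚ`. -/
def conjIndex (a ℓ : ℤ) : ℤ :=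
  ⌊(1 / 2 : ℚ) * ((ℓ : ℚ) / (a : ℚ) + 1)⌋

/-- The function `ℓ ↦ k (ℓ - a k)` with `k = ⌊(ℓ / a + 1) / 2⌋`. -/
def squareConj (a ℓ : ℤ) : ℤ :=
  conjIndex a ℓ * (ℓ - a * conjIndex a ℓ)

end Defs

/-! Weak duality: for integral x in B, summation by parts gives p̂(π) ≤ ∑ π(s)x(s), and conjugacy
gives π(s)x(s) − ψ(π(s)) ≤ c(s)x(s)². For equality, take a minimizer x. If every tight set
containing t contains s, then x + e_s − e_t stays in B, so minimality yields c(t)(2x(t) − 1) ≤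
c(s)(2x(s) + 1). These inequalities leave room for an integral π with c(s)(2x(s) − 1) ≤ π(s) ≤
c(s)(2x(s) + 1) that is monotone along this relation (`exists_dual_of_minimizer`). The bounds make
conjugacy tight. Monotonicity makes the superlevel sets of π tight (`isTight_of_separated`), so
p̂(π) = ∑ π(s)x(s). -/

/-- A set is tight for `x` if `p Z = x(Z)`. -/
def IsTight {S : Type*} (p : Finset S → WithBot ℤ) (x : S → ℤ) (Z : Finset S) : Prop :=
  p Z = ((∑ s ∈ Z, x s : ℤ) : WithBot ℤ)

/-- `x(Z) ≥ p(Z)` for all `Z`. -/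
def Dominates {S : Type*} (p : Finset S → WithBot ℤ) (x : S → ℤ) : Prop :=
  ∀ Z : Finset S, p Z ≤ ((∑ s ∈ Z, x s : ℤ) : WithBot ℤ)

theorem mem_integralPoints_basePolyhedron {S : Type*} [Fintype S] {p : Finset S → WithBot ℤ}
    {x : S → ℤ} :
    x ∈ integralPoints (basePolyhedron p) ↔ IsTight p x Finset.univ ∧ Dominates p x := by
  have h1 : ∀ (w : WithBot ℤ) (k : ℤ),
      ((k : ℝ) : WithBot ℝ) = w.map (fun k : ℤ => (k : ℝ)) ↔ w = (k : WithBot ℤ) := by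
    intro w k
    induction w using WithBot.recBotCoe with
    | bot => simp
    | coe a => simp only [WithBot.map_coe, WithBot.coe_inj, Int.cast_inj, eq_comm]
  have h2 : ∀ (w : WithBot ℤ) (k : ℤ),
      w.map (fun k : ℤ => (k : ℝ)) ≤ ((k : ℝ) : WithBot ℝ) ↔ w ≤ (k : WithBot ℤ) := by
    intro w k
    induction w using WithBot.recBotCoe with
    | bot => simp
    | coe a => simp only [WithBot.map_coe, WithBot.coe_le_coe, Int.cast_le]
  simp only [integralPoints, basePolyhedron, Set.mem_ofPred_eq, IsTight, Dominates, ← Int.cast_sum,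
    h1, h2]

/-! ### Tight sets and integral points of the base-polyhedron -/

/-- Since x is modular and p supermodular, the slacks on the intersection and union are nonnegative
with sum at most zero. -/
theorem IsTight.inter_union {S : Type*} [DecidableEq S] {p : Finset S → WithBot ℤ}
    (hp : IsSupermodular p) {x : S → ℤ} (hx : Dominates p x) {X Y : Finset S}
    (hX : IsTight p x X) (hY : IsTight p x Y) : IsTight p x (X ∩ Y) ∧ IsTight p x (X ∪ Y) := by
  have h := hp X Y
  have hi := hx (X ∩ Y)
  have hu := hx (X ∪ Y)
  have hs := Finset.sum_union_inter (s₁ := X) (s₂ := Y) (f := x)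
  unfold IsTight at *
  rw [hX, hY] at h
  revert h hi hu
  generalize p (X ∩ Y) = a
  generalize p (X ∪ Y) = b
  induction a using WithBot.recBotCoe with
  | bot => intro h; rw [WithBot.bot_add, ← WithBot.coe_add] at h; exact absurd (le_bot_iff.mp h) WithBot.coe_ne_bot
  | coe a =>
    induction b using WithBot.recBotCoe with
    | bot => intro h; rw [WithBot.add_bot, ← WithBot.coe_add] at h; exact absurd (le_bot_iff.mp h) WithBot.coe_ne_bot
    | coe b =>
      simp only [← WithBot.coe_add, WithBot.coe_le_coe, WithBot.coe_inj]
      omega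

/-- Take a dominating integral vector of least total. An element in no tight set could be lowered by
1, so the tight sets cover S and their union, S itself, is tight. -/
theorem exists_mem_integralPoints_basePolyhedron {S : Type*} [Fintype S] [DecidableEq S]
    {p : Finset S → WithBot ℤ} (hp : IsSupermodular p) (hp_empty : p ∅ = 0)
    (hp_univ : p Finset.univ ≠ ⊥) : ∃ x, x ∈ integralPoints (basePolyhedron p) := by
  obtain ⟨q, hq⟩ := WithBot.ne_bot_iff_exists.mp hp_univ
  have hne : ∃ x, Dominates p x := by
    let M : ℤ := ∑ Z : Finset S, |(p Z).unbotD 0|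
    have hM : ∀ Z, p Z ≤ (M : WithBot ℤ) := by
      intro Z
      have hle : |(p Z).unbotD 0| ≤ M :=
        Finset.single_le_sum (f := fun Z => |(p Z).unbotD 0|) (fun _ _ => abs_nonneg _)
          (Finset.mem_univ Z)
      revert hle
      generalize p Z = a
      induction a using WithBot.recBotCoe with
      | bot => simp
      | coe a =>
        intro hle
        rw [WithBot.coe_le_coe]
        exact (le_abs_self a).trans hle
    have hM0 : 0 ≤ M := Finset.sum_nonneg fun _ _ => abs_nonneg _
    refine ⟨fun _ => M, fun Z => ?_⟩
    rcases Z.eq_empty_or_nonempty with rfl | ⟨s, hs⟩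
    · simp [hp_empty]
    · exact (hM Z).trans (WithBot.coe_le_coe.mpr
        (Finset.single_le_sum (f := fun _ => M) (fun _ _ => hM0) hs))
  let f : (S → ℤ) → ℕ := fun x => (∑ s, x s - q).toNat
  obtain ⟨x, hx, hmin⟩ := WellFounded.has_min (measure f).wf {x | Dominates p x} hne
  have hcover : ∀ s, ∃ Z, s ∈ Z ∧ IsTight p x Z := by
    by_contra! hcon
    obtain ⟨s, hs⟩ := hcon
    let y : S → ℤ := x - Pi.single s 1
    have hy : ∀ Z : Finset S, ∑ t ∈ Z, y t = ∑ t ∈ Z, x t - if s ∈ Z then 1 else 0 := by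
      intro Z
      simp [y, Finset.sum_sub_distrib]
    have hyd : Dominates p y := by
      intro Z
      rw [hy]
      have hxZ := hx Z
      have hsZ := hs Z
      split_ifs with hmem
      · have hlt := lt_of_le_of_ne hxZ (hsZ hmem)
        revert hlt
        generalize p Z = a
        induction a using WithBot.recBotCoe with
        | bot => simp
        | coe a =>
          rw [WithBot.coe_lt_coe, WithBot.coe_le_coe]
          omega
      · simpa using hxZ
    refine hmin y hyd ?_
    have h1 := hy Finset.univ
    have h2 := hyd Finset.univ
    rw [← hq, WithBot.coe_le_coe] at h2
    simp only [Finset.mem_univ, if_true] at h1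
    change f y < f x
    simp only [f]
    omega
  refine ⟨x, mem_integralPoints_basePolyhedron.mpr ⟨?_, hx⟩⟩
  choose Z hsZ hZ using hcover
  have h : IsTight p x (Finset.univ.sup Z) :=
    Finset.sup_induction (by simp [IsTight, hp_empty])
      (fun _ ha _ hb => (ha.inter_union hp hx hb).2) (fun s _ => hZ s)
  rwa [Finset.eq_univ_iff_forall.mpr fun s =>
    Finset.mem_sup.mpr ⟨s, Finset.mem_univ s, hsZ s⟩] at h

/-- A set which can be separated from its complement, point by point, by tight sets is tight. -/
theorem isTight_of_separated {S : Type*} [Fintype S] [DecidableEq S]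
    {p : Finset S → WithBot ℤ} (hp : IsSupermodular p) (hp_empty : p ∅ = 0) {x : S → ℤ}
    (hx : Dominates p x) (hu : IsTight p x Finset.univ) (L : Finset S)
    (hL : ∀ t ∈ L, ∀ s ∉ L, ∃ Z, IsTight p x Z ∧ t ∈ Z ∧ s ∉ Z) : IsTight p x L := by
  choose! Z hZ htZ hsZ using hL
  -- This intersection contains t and avoids the complement of L, so the union over t in L is L.
  -- `hu` covers the empty intersection.
  have hD : ∀ t ∈ L, IsTight p x (Lᶜ.inf (Z t)) := fun t ht =>
    Finset.inf_induction (by simpa using hu) (fun _ ha _ hb => (ha.inter_union hp hx hb).1)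
      (fun s hs => hZ t ht s (Finset.mem_compl.mp hs))
  have h : IsTight p x (L.sup fun t => Lᶜ.inf (Z t)) :=
    Finset.sup_induction (by simp [IsTight, hp_empty])
      (fun _ ha _ hb => (ha.inter_union hp hx hb).2) hD
  convert h using 1
  ext s
  simp only [Finset.mem_sup, Finset.mem_inf]
  refine ⟨fun hs => ⟨s, hs, fun r hr => htZ s hs r (Finset.mem_compl.mp hr)⟩, ?_⟩
  rintro ⟨t, ht, h⟩
  by_contra hs
  exact hsZ t ht s hs (h s (Finset.mem_compl.mpr hs))

/-- Only sets containing t but not s lose value; they are not tight, so by integrality they have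
slack at least 1. -/
theorem exchange_mem_integralPoints {S : Type*} [Fintype S] [DecidableEq S]
    {p : Finset S → WithBot ℤ} {x : S → ℤ} (hx : x ∈ integralPoints (basePolyhedron p)) {s t : S}
    (h : ∀ Z, IsTight p x Z → t ∈ Z → s ∈ Z) :
    x + Pi.single s 1 - Pi.single t 1 ∈ integralPoints (basePolyhedron p) := by
  obtain ⟨hu, hd⟩ := mem_integralPoints_basePolyhedron.mp hx
  have hy : ∀ Z : Finset S, ∑ r ∈ Z, (x + Pi.single s 1 - Pi.single t 1 : S → ℤ) r =
      ∑ r ∈ Z, x r + (if s ∈ Z then 1 else 0) - if t ∈ Z then 1 else 0 := by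
    intro Z
    simp [Finset.sum_sub_distrib, Finset.sum_add_distrib]
  refine mem_integralPoints_basePolyhedron.mpr ⟨?_, fun Z => ?_⟩
  · unfold IsTight
    rw [hy, hu]
    simp
  · rw [hy]
    have hZ := hd Z
    by_cases ht : IsTight p x Z
    · refine hZ.trans (WithBot.coe_le_coe.mpr ?_)
      have := h Z ht
      split_ifs <;> simp_all
    · have hlt := lt_of_le_of_ne hZ ht
      revert hlt
      generalize p Z = a
      induction a using WithBot.recBotCoe with
      | bot => simp
      | coe a =>
        rw [WithBot.coe_lt_coe, WithBot.coe_le_coe]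
        split_ifs <;> omega

/-! ### The Lovász extension against a linear functional -/

/-- Summation by parts on `Fin (m + 1)`. -/
theorem Fin.sum_mul_eq_sum_Iic_mul_sub {m : ℕ} (a b : Fin (m + 1) → ℤ) :
    ∑ i, a i * b i = (∑ i ∈ Finset.Iic (Fin.last m), a i) * b (Fin.last m) +
      ∑ j : Fin m, (∑ i ∈ Finset.Iic j.castSucc, a i) * (b j.castSucc - b j.succ) := by
  induction m with
  | zero =>
    have h : (Finset.Iic (Fin.last 0) : Finset (Fin 1)) = {0} := by decide
    rw [h]
    simp
  | succ m ih =>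
    have hcast : ∀ j : Fin (m + 1), ∑ i ∈ Finset.Iic j.castSucc, a i =
        ∑ i ∈ Finset.Iic j, a i.castSucc := by
      intro j
      rw [← Fin.map_castSuccEmb_Iic, Finset.sum_map]
      rfl
    have hlast : ∑ i ∈ Finset.Iic (Fin.last (m + 1)), a i =
        ∑ i ∈ Finset.Iic (Fin.last m), a i.castSucc + a (Fin.last (m + 1)) := by
      have h1 : Finset.Iic (Fin.last (m + 1)) = Finset.univ := by ext; simp [Fin.le_last]
      have h2 : Finset.Iic (Fin.last m) = Finset.univ := by ext; simp [Fin.le_last]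
      rw [h1, h2, Fin.sum_univ_castSucc]
    rw [Fin.sum_univ_castSucc, ih (fun i => a i.castSucc) (fun i => b i.castSucc),
      Fin.sum_univ_castSucc, hlast]
    simp only [hcast, Fin.succ_last, Fin.succ_castSucc]
    ring

theorem sum_mul_eq_sum_initialSegment {S : Type*} [Fintype S] {m : ℕ} (x π : S → ℤ)
    (e : Fin (m + 1) ≃ S) :
    ∑ s, x s * π s = (∑ s ∈ initialSegment e (Fin.last m), x s) * π (e (Fin.last m)) +
      ∑ j : Fin m, (∑ s ∈ initialSegment e j.castSucc, x s) *
        (π (e j.castSucc) - π (e j.succ)) := by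
  rw [← e.sum_comp, Fin.sum_mul_eq_sum_Iic_mul_sub (fun i => x (e i)) (fun i => π (e i))]
  simp only [initialSegment, Finset.sum_map, Equiv.coe_toEmbedding]

theorem lovaszExtension_le {S : Type*} [Fintype S] [Nonempty S] {p : Finset S → WithBot ℤ}
    {x : S → ℤ} (hx : x ∈ integralPoints (basePolyhedron p)) (π : S → ℤ) :
    lovaszExtension p π ≤ ((∑ s, x s * π s : ℤ) : WithBot ℤ) := by
  obtain ⟨hu, hd⟩ := mem_integralPoints_basePolyhedron.mp hx
  obtain ⟨e, he⟩ := exists_antitone_enum π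
  rw [lovaszExtension_eq p π e he, sum_mul_eq_sum_initialSegment x π e, WithBot.coe_add,
    WithBot.coe_sum, lovaszAlong]
  refine add_le_add (le_of_eq ?_) (Finset.sum_le_sum fun j _ => ?_)
  · rw [initialSegment_last, hu, WithBot.coe_mul]
  · have hle : π (e j.succ) ≤ π (e j.castSucc) := he (Fin.castSucc_lt_succ (i := j)).le
    rw [WithBot.coe_mul]
    exact mul_le_mul_of_nonneg_right (hd _) (WithBot.coe_le_coe.mpr (sub_nonneg.mpr hle))

/-- Initial segments at strict drops of π are superlevel sets; at ties the coefficient 0 cancels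
even the value −∞. -/
theorem lovaszExtension_eq_of_isTight {S : Type*} [Fintype S] [Nonempty S]
    {p : Finset S → WithBot ℤ} {x : S → ℤ} (hu : IsTight p x Finset.univ) (π : S → ℤ)
    (h : ∀ t, IsTight p x (Finset.univ.filter fun s => π t ≤ π s)) :
    lovaszExtension p π = ((∑ s, x s * π s : ℤ) : WithBot ℤ) := by
  obtain ⟨e, he⟩ := exists_antitone_enum π
  rw [lovaszExtension_eq p π e he, sum_mul_eq_sum_initialSegment x π e, WithBot.coe_add,
    WithBot.coe_sum, lovaszAlong]
  congr 1
  · rw [initialSegment_last, hu, WithBot.coe_mul]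
  · refine Finset.sum_congr rfl fun j _ => ?_
    have hle : π (e j.succ) ≤ π (e j.castSucc) := he (Fin.castSucc_lt_succ (i := j)).le
    rcases hle.lt_or_eq with hlt | heq
    · rw [initialSegment_eq_of_lt π e he j hlt, h, WithBot.coe_mul]
    · simp [heq]

/-! ### The discrete conjugate of the square -/

/-- By concavity, comparing k with its two neighbours suffices: the gap factors as (k − j)(l − a(k +
j)), with both factors of the same sign. -/
theorem mul_sub_sq_le {a l k : ℤ} (ha : 0 ≤ a) (h1 : a * (2 * k - 1) ≤ l)
    (h2 : l ≤ a * (2 * k + 1)) (j : ℤ) : j * l - a * j ^ 2 ≤ k * l - a * k ^ 2 := by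
  rcases lt_trichotomy j k with h | rfl | h
  · have : 0 ≤ (k - j) * (l - a * (k + j)) :=
      mul_nonneg (by omega) (by nlinarith [mul_nonneg ha (show 0 ≤ k - 1 - j by omega)])
    linarith
  · exact le_rfl
  · have : 0 ≤ (j - k) * (a * (k + j) - l) :=
      mul_nonneg (by omega) (by nlinarith [mul_nonneg ha (show 0 ≤ j - (k + 1) by omega)])
    linarith

theorem isGreatest_squareConj {a : ℤ} (ha : 0 < a) (l : ℤ) :
    IsGreatest {w : ℤ | ∃ k : ℤ, w = k * l - a * k ^ 2} (squareConj a l) := by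
  refine ⟨⟨conjIndex a l, by unfold squareConj; ring⟩, ?_⟩
  rintro _ ⟨j, rfl⟩
  have haq : (0 : ℚ) < a := by exact_mod_cast ha
  have hl : (a : ℚ) * ((l : ℚ) / a) = l := mul_div_cancel₀ _ haq.ne'
  have hf : (conjIndex a l : ℚ) ≤ 1 / 2 * ((l : ℚ) / a + 1) := Int.floor_le _
  have hg : 1 / 2 * ((l : ℚ) / a + 1) < conjIndex a l + 1 := Int.lt_floor_add_one _
  have h1 : a * (2 * conjIndex a l - 1) ≤ l := by
    have : (a : ℚ) * (2 * conjIndex a l - 1) ≤ l := by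
      rw [← hl]; exact mul_le_mul_of_nonneg_left (by linarith) haq.le
    exact_mod_cast this
  have h2 : l ≤ a * (2 * conjIndex a l + 1) := by
    have : (l : ℚ) ≤ a * (2 * conjIndex a l + 1) := by
      rw [← hl]; exact mul_le_mul_of_nonneg_left (by linarith) haq.le
    exact_mod_cast this
  refine (mul_sub_sq_le ha.le h1 h2 j).trans (le_of_eq ?_)
  unfold squareConj
  ring

theorem squareConj_eq {a l k : ℤ} (ha : 0 < a) (h1 : a * (2 * k - 1) ≤ l)
    (h2 : l ≤ a * (2 * k + 1)) : squareConj a l = k * l - a * k ^ 2 :=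
  (isGreatest_squareConj ha l).unique
    ⟨⟨k, rfl⟩, by rintro _ ⟨j, rfl⟩; exact mul_sub_sq_le ha.le h1 h2 j⟩

/-! ### Optimal potential and duality -/

/-- A minimizer of `∑ c(s) x(s)²` admits an optimal dual solution. -/
theorem exists_dual_of_minimizer {S : Type*} [Fintype S] [DecidableEq S] [Nonempty S]
    {p : Finset S → WithBot ℤ} (hp : IsSupermodular p) (hp_empty : p ∅ = 0) {c x : S → ℤ}
    (hc : ∀ s, 1 ≤ c s) (hx : x ∈ integralPoints (basePolyhedron p))
    (hmin : ∀ y ∈ integralPoints (basePolyhedron p), ∑ s, c s * x s ^ 2 ≤ ∑ s, c s * y s ^ 2) :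
    ∃ π : S → ℤ, lovaszExtension p π = ((∑ s, x s * π s : ℤ) : WithBot ℤ) ∧
      ∀ s, c s * (2 * x s - 1) ≤ π s ∧ π s ≤ c s * (2 * x s + 1) := by
  classical
  obtain ⟨hu, hd⟩ := mem_integralPoints_basePolyhedron.mp hx
  let R : S → S → Prop := fun t s => ∀ Z, IsTight p x Z → t ∈ Z → s ∈ Z
  have hlocal : ∀ t s, R t s → c t * (2 * x t - 1) ≤ c s * (2 * x s + 1) := by
    intro t s hR
    by_cases hst : s = t
    · subst hst
      nlinarith [hc s]
    have hle := hmin _ (exchange_mem_integralPoints hx hR)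
    have hval : ∀ r, c r * (x + Pi.single s 1 - Pi.single t 1 : S → ℤ) r ^ 2 = c r * x r ^ 2 +
        (if r = s then c s * (2 * x s + 1) else 0) +
        (if r = t then -(c t * (2 * x t - 1)) else 0) := by
      intro r
      by_cases hrs : r = s
      · subst hrs
        simp [hst]
        ring
      · by_cases hrt : r = t
        · subst hrt
          simp [hrs]
          ring
        · simp [hrs, hrt]
    simp only [hval, Finset.sum_add_distrib, Finset.sum_ite_eq', Finset.mem_univ, if_true] at hle
    linarith
  have hrefl : ∀ s, s ∈ Finset.univ.filter fun t => R t s := fun s => by simp [R]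
  -- The least potential that respects the lower bounds and is monotone along the transitive
  -- relation `R`; `hlocal` supplies the upper bounds.
  let π : S → ℤ := fun s =>
    (Finset.univ.filter fun t => R t s).sup' ⟨s, hrefl s⟩ fun t => c t * (2 * x t - 1)
  have hmono : ∀ t s, R t s → π t ≤ π s := by
    intro t s hts
    refine Finset.sup'_mono _ (fun r hr => ?_) _
    simp only [Finset.mem_filter, Finset.mem_univ, true_and] at hr ⊢
    exact fun Z hZ hrZ => hts Z hZ (hr Z hZ hrZ)
  refine ⟨π, lovaszExtension_eq_of_isTight hu π fun t => ?_, fun s => ⟨?_, ?_⟩⟩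
  · refine isTight_of_separated hp hp_empty hd hu _ fun r hr s hs => ?_
    simp only [Finset.mem_filter, Finset.mem_univ, true_and] at hr hs
    -- If no tight set separates r from s, then `R r s` holds, and monotonicity puts s in the
    -- superlevel set.
    by_contra! hcon
    exact hs (hr.trans (hmono r s hcon))
  · exact Finset.le_sup' (fun t => c t * (2 * x t - 1)) (hrefl s)
  · refine Finset.sup'_le _ _ fun t ht => hlocal t s ?_
    simpa using ht

theorem mainTheorem10 {S : Type*} [Fintype S] [DecidableEq S] [Nonempty S]
    (p : Finset S → WithBot ℤ) (hp : IsSupermodular p) (hp_empty : p ∅ = 0)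
    (hp_univ : p Finset.univ ≠ ⊥) (c : S → ℤ) (hc : ∀ s, 1 ≤ c s) :
    (∃ v : ℤ,
      IsLeast {z : ℤ | ∃ x ∈ integralPoints (basePolyhedron p), z = ∑ s, c s * x s ^ 2} v ∧
      IsGreatest {w : WithBot ℤ | ∃ π : S → ℤ,
        w = lovaszExtension p π + ((-∑ s, squareConj (c s) (π s) : ℤ) : WithBot ℤ)}
        (v : WithBot ℤ)) ∧
    ∀ (s : S) (l : ℤ),
      IsGreatest {w : ℤ | ∃ k : ℤ, w = k * l - c s * k ^ 2} (squareConj (c s) l) := by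
  refine ⟨?_, fun s l => isGreatest_squareConj (hc s) l⟩
  let f : (S → ℤ) → ℤ := fun x => ∑ s, c s * x s ^ 2
  have hf : ∀ x, 0 ≤ f x := fun x => Finset.sum_nonneg fun s _ =>
    mul_nonneg (zero_le_one.trans (hc s)) (sq_nonneg _)
  obtain ⟨x, hx, hmin⟩ := WellFounded.has_min (measure fun x => (f x).toNat).wf _
    (exists_mem_integralPoints_basePolyhedron hp hp_empty hp_univ)
  have hmin' : ∀ y ∈ integralPoints (basePolyhedron p), f x ≤ f y := by
    intro y hy
    have h : ¬ (f y).toNat < (f x).toNat := hmin y hy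
    have := hf x
    have := hf y
    omega
  refine ⟨f x, ⟨⟨x, hx, rfl⟩, ?_⟩, ?_, ?_⟩
  · rintro _ ⟨y, hy, rfl⟩
    exact hmin' y hy
  · obtain ⟨π, hπ, hbd⟩ := exists_dual_of_minimizer hp hp_empty hc hx hmin'
    refine ⟨π, ?_⟩
    rw [hπ, ← WithBot.coe_add, WithBot.coe_inj, ← sub_eq_add_neg, ← Finset.sum_sub_distrib]
    refine Finset.sum_congr rfl fun s _ => ?_
    rw [squareConj_eq (hc s) (hbd s).1 (hbd s).2]
    ring
  · rintro _ ⟨π, rfl⟩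
    refine (add_le_add_left (lovaszExtension_le hx π) _).trans ?_
    rw [← WithBot.coe_add, WithBot.coe_le_coe, ← sub_eq_add_neg, ← Finset.sum_sub_distrib]
    refine Finset.sum_le_sum fun s _ => ?_
    have h := (isGreatest_squareConj (hc s) (π s)).2 ⟨x s, rfl⟩
    linarith
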